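/- Let $X$ be a countably infinite set, $m:X\to(0,\infty)$, and let $b:X\times X\to[0,\infty)$ be symmetric with zero diagonal and $\sum_y b(x,y)<\infty$ for all $x$; write $x\sim y$ if $b(x,y)>0$. Such a $b$ is called a graph over $(X,m)$. Assume that $b$ is connected and locally finite (each vertex has finitely many neighbors). Let $\mathcal Q(f)=\frac12\sum_{x,y}b(x,y)(f(x)-f(y))^2$, let $L$ be the Laplacian on $\ell^2(X,m)$, i.e. the self-adjoint operator associated to the closure of $\mathcal Q$ restricted to the finitely supported functions, and assume that $$\lambda_0=\inf_{0\ne\varphi\in C_c(X)}\frac{\mathcal Q(\varphi)}{\|\varphi\|^2_{\ell^2(X,m)}}>0 .$$ Let $p_t(x,y)$ be the heat kernel, $e^{-tL}f(x)=\sum_y p_t(x,y)f(y)m(y)$, and $G(x,y)=\int_0^\infty p_t(x,y)\,dt$ the Green's function (which is finite as $\lambda_0>0$). Fix $o\in X$, put $g(x)=G(o,x)$, and let $N_o=\{x\sim o: g(x)\neq g(o)\}$ and $N_c=\{x\sim o: g(x)=g(o)\}$. Let $X_o=(X\setminus\{o\})\cup\bigcup_{x\in N_o}\{x_1,x_2,\dots\}\cup\bigcup_{x\in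 N_c}\{x_c\}$, all new vertices being distinct. Let $m_o:X_o\to(0,\infty)$ be an arbitrary extension of $m|_{X\setminus\{o\}}$, and let $b_o$ be a graph over $(X_o,m_o)$ with $b_o=b$ on $(X\setminus\{o\})^2$, $b_o(x,x_1)>0$ for $x\in N_o$, $b_o(x_j,x_k)>0$ if and only if $|j-k|=1$ for $x\in N_o$, $b_o(x,x_c)>0$ for $x\in N_c$, and $b_o=0$ on all other pairs (up to symmetry). Suppose that for every $x\in N_o$ $$\sum_{r=1}^\infty\Big(\sum_{n=1}^r\frac1{b_o(x_n,x_{n+1})}\Big)^2 m_o(x_{r+1})<\infty .$$ A length function is a symmetric $\sigma:X_o\times X_o\to[0,\infty)$ with $\sigma(u,v)>0$ if and only if $u\sim v$ in $b_o$. Its path metric $d_\sigma(u,v)$ is the infimum of the lengths $\sum_k\sigma(u_k,u_{k+1})$ of the finite paths $(u_k)$ from $u$ to $v$ (with $d_\sigma(u,v)=\infty$ if $u,v$ lie in different connected components of $b_o$). It is intrinsic if $\sum_{v}b_o(u,v)d_\sigma(u,v)^2\le m_o(u)$ for all $u\in X_o$ (with the convention $0\cdot\infty=0$). Then $b_o$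 over $(X_o,m_o)$ is not complete with respect to any intrinsic path metric: for every length function $\sigma$ such that $d_\sigma$ is intrinsic, there is an infinite geodesic of finite length (that is, $b_o$ is not geodesically complete), $(X_o,d_\sigma)$ is not metrically complete, and some ball of finite radius is infinite. Moreover, for every such $\sigma$, each attached path has finite length: $\sum_{n\ge1}\sigma(x_n,x_{n+1})<\infty$ for every $x\in N_o$. -/

import Mathlib

/-- The operator `e^{-tL}`, `t > 0`, for a self-adjoint operator `L ≥ 0` with `R = (L + 1)⁻¹`, by the
spectral calculus. A spectral value `l ≥ 0` of `L` corresponds to the spectral value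
`s = 1 / (1 + l)` of `R`, so that `e^{-tL} = φ_t(R)` where `φ_t(s) = e^{-t(1/s - 1)}` for `s > 0`
and `φ_t(0) = 0`; the function `φ_t` is continuous on `[0, 1]`. -/
noncomputable def expNegOfResolvent {H : Type*} [NormedAddCommGroup H] [InnerProductSpace ℂ H]
    [CompleteSpace H] (R : H →L[ℂ] H) (t : ℝ) : H →L[ℂ] H :=
  cfc (fun s : ℝ => if 0 < s then Real.exp (-t * (1 / s - 1)) else 0) R

/-- A weighted graph `b` over a discrete measure space `(V, m)`. -/
structure WeightedGraph (V : Type*) where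
  b : V → V → ℝ
  m : V → ℝ
  b_nonneg : ∀ x y, 0 ≤ b x y
  b_self : ∀ x, b x x = 0
  b_symm : ∀ x y, b x y = b y x
  b_summable : ∀ x, Summable (b x)
  m_pos : ∀ x, 0 < m x

namespace WeightedGraph

variable {V : Type*}

/-- The underlying combinatorial graph: `x ∼ y` if and only if `b x y > 0`. -/
def toSimpleGraph (G : WeightedGraph V) : SimpleGraph V where
  Adj x y := 0 < G.b x y
  symm := ⟨fun x y h => by rw [G.b_symm y x]; exact h⟩
  loopless := ⟨fun x h => by rw [G.b_self x] at h; exact lt_irrefl _ h⟩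

/-- Every vertex has only finitely many neighbors. -/
def IsLocallyFinite (G : WeightedGraph V) : Prop :=
  ∀ x, {y | G.toSimpleGraph.Adj x y}.Finite

/-! ### Energy form and bottom of the spectrum -/

/-- The energy `½ ∑_{x,y} b(x,y) (f(x) - f(y))²`; here only used for finitely supported `f`, for
which the sum converges. -/
noncomputable def energy (G : WeightedGraph V) (f : V → ℝ) : ℝ :=
  (1 / 2) * ∑' p : V × V, G.b p.1 p.2 * (f p.1 - f p.2) ^ 2

/-- The squared norm of `f` in `ℓ²(V, m)`. -/
noncomputable def normSq (G : WeightedGraph V) (f : V → ℝ) : ℝ :=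
  ∑' x, f x ^ 2 * G.m x

/-- The bottom of the spectrum of the Laplacian: the infimum of the Rayleigh quotient over the
nonzero finitely supported functions. -/
noncomputable def lambda0 (G : WeightedGraph V) : ℝ :=
  sInf {c : ℝ | ∃ φ : V →₀ ℝ, φ ≠ 0 ∧ c = G.energy φ / G.normSq φ}

/-! ### The Laplacian, the heat semigroup, the heat kernel and the Green's function

The functional calculus is carried out over the complex numbers. The Hilbert space `ℓ²(V, m)` is
represented by the unweighted `ℓ²(V)` through the unitary map `f ↦ √m · f`. -/

/-- The Hilbert space `ℓ²(V)`; the function `f ∈ ℓ²(V, m)` is represented by `√m · f`. -/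
abbrev Ell2 (V : Type*) : Type _ := lp (fun _ : V => ℂ) 2

/-- The Hilbert space containing the pairs `(f, df)` of a function and its discrete gradient. -/
abbrev GradSpace (V : Type*) : Type _ := WithLp 2 (Ell2 V × Ell2 (V × V))

/-- The space of finitely supported functions `φ`, each represented by the pair
`(√m φ, √(b/2) dφ)`, where `dφ(x,y) = φ(x) - φ(y)`. The squared norm of this pair is the squared
form norm `‖φ‖² + Q(φ)`. -/
noncomputable def formCore (G : WeightedGraph V) : Submodule ℂ (GradSpace V) where
  carrier := {v | ∃ φ : V →₀ ℂ,
    (∀ x, v.fst x = (Real.sqrt (G.m x) : ℂ) * φ x) ∧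
    ∀ p : V × V, v.snd p = (Real.sqrt (G.b p.1 p.2 / 2) : ℂ) * (φ p.1 - φ p.2)}
  zero_mem' := ⟨0, by simp, by simp⟩
  add_mem' := by
    rintro v w ⟨φ, h1, h2⟩ ⟨ψ, h3, h4⟩
    refine ⟨φ + ψ, fun x => ?_, fun p => ?_⟩
    · simp [h1, h3, mul_add]
    · simp only [WithLp.add_snd, lp.coeFn_add, Pi.add_apply, h2, h4, Finsupp.add_apply]
      ring
  smul_mem' := by
    rintro c v ⟨φ, h1, h2⟩
    refine ⟨c • φ, fun x => ?_, fun p => ?_⟩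
    · simp [h1]; ring
    · simp only [WithLp.smul_snd, lp.coeFn_smul, Pi.smul_apply, h2, Finsupp.smul_apply, smul_eq_mul]
      ring

/-- The domain of the closed form `Q`, i.e. the closure of the finitely supported functions with
respect to the form norm (with `f` again represented by `(√m f, √(b/2) df)`). -/
noncomputable def formDomain (G : WeightedGraph V) : Submodule ℂ (GradSpace V) :=
  G.formCore.topologicalClosure

instance (G : WeightedGraph V) : CompleteSpace G.formDomain :=
  G.formCore.isClosed_topologicalClosure.completeSpace_coe

/-- The (graph of the) Laplacian `L`, the self-adjoint operator associated to the closed form `Q`: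
`u ∈ D(L)` and `L u = h` if and only if `u ∈ D(Q)` and `Q(w, u) = ⟪w, h⟫` for all `w ∈ D(Q)`. -/
def IsLaplacian (G : WeightedGraph V) (u h : Ell2 V) : Prop :=
  ∃ v ∈ G.formDomain, v.fst = u ∧ ∀ w ∈ G.formDomain, inner ℂ w.snd v.snd = inner ℂ w.fst h

/-- The inclusion of the form domain (with the form norm) into `ℓ²`. -/
noncomputable def formIncl (G : WeightedGraph V) : G.formDomain →L[ℂ] Ell2 V :=
  (WithLp.fstL 2 ℂ (Ell2 V) (Ell2 (V × V))).comp G.formDomain.subtypeL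

/-- The resolvent `(L + 1)⁻¹` on `ℓ²`; see `isLaplacian_iff`. -/
noncomputable def resolvent (G : WeightedGraph V) : Ell2 V →L[ℂ] Ell2 V :=
  G.formIncl.comp (ContinuousLinearMap.adjoint G.formIncl)

/-- `resolvent` is indeed `(L + 1)⁻¹`: `L u = h` if and only if `(L + 1)⁻¹ (u + h) = u`. -/
theorem isLaplacian_iff (G : WeightedGraph V) (u h : Ell2 V) :
    G.IsLaplacian u h ↔ G.resolvent (u + h) = u := by
  constructor
  · rintro ⟨v, hv, rfl, hL⟩
    have key : ContinuousLinearMap.adjoint G.formIncl (v.fst + h) = ⟨v, hv⟩ := by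
      refine ext_inner_left ℂ fun w => ?_
      rw [ContinuousLinearMap.adjoint_inner_right, Submodule.coe_inner, WithLp.prod_inner_apply]
      change inner ℂ (w : GradSpace V).fst (v.fst + h) = inner ℂ (w : GradSpace V).fst v.fst +
        inner ℂ (w : GradSpace V).snd v.snd
      rw [inner_add_right, hL w w.2]
    change G.formIncl (ContinuousLinearMap.adjoint G.formIncl (v.fst + h)) = v.fst
    rw [key]
    rfl
  · intro hR
    refine ⟨ContinuousLinearMap.adjoint G.formIncl (u + h), Subtype.coe_prop _, hR, fun w hw => ?_⟩
    have e := ContinuousLinearMap.adjoint_inner_right G.formIncl (⟨w, hw⟩ : G.formDomain) (u + h)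
    rw [Submodule.coe_inner, WithLp.prod_inner_apply] at e
    change inner ℂ w.fst (G.resolvent (u + h)) + inner ℂ w.snd
      (ContinuousLinearMap.adjoint G.formIncl (u + h) : GradSpace V).snd =
        inner ℂ w.fst (u + h) at e
    rw [hR, inner_add_right] at e
    exact add_left_cancel e

/-- The heat semigroup `e^{-tL}`, `t > 0`, on `ℓ²`. -/
noncomputable def heatSemigroup (G : WeightedGraph V) (t : ℝ) : Ell2 V →L[ℂ] Ell2 V :=
  expNegOfResolvent G.resolvent t

open Classical in
/-- The heat kernel `p_t(x, y)`, `t > 0`, determined by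
`(e^{-tL} f)(x) = ∑_y p_t(x, y) f(y) m(y)`, that is, `p_t(x, y) = (e^{-tL} 1_y)(x) / m(y)`.
The function `1_y` is represented by `√(m y) e_y`, which gives the formula below. -/
noncomputable def heatKernel (G : WeightedGraph V) (t : ℝ) (x y : V) : ℝ :=
  (G.heatSemigroup t (lp.single 2 y (1 : ℂ)) x).re / (Real.sqrt (G.m x) * Real.sqrt (G.m y))

/-- The Green's function `G(x, y) = ∫_0^∞ p_t(x, y) dt` of a transient graph (where the integral
is finite; this covers all connected graphs with positive bottom of the spectrum). -/
noncomputable def green (G : WeightedGraph V) (x y : V) : ℝ :=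
  ∫ t in Set.Ioi (0 : ℝ), G.heatKernel t x y

/-! ### Removing a vertex and attaching paths -/

/-- The neighbors `x` of `o` with `g(x) ≠ g(o)`, where `g(x) = G(o, x)`. -/
def pathNeighbors (G : WeightedGraph V) (o : V) : Set V :=
  {x | G.toSimpleGraph.Adj x o ∧ G.green o x ≠ G.green o o}

/-- The neighbors `x` of `o` with `g(x) = g(o)`, where `g(x) = G(o, x)`. -/
def constNeighbors (G : WeightedGraph V) (o : V) : Set V :=
  {x | G.toSimpleGraph.Adj x o ∧ G.green o x = G.green o o}

/-- The vertex set `X_o`: the old vertices `x ≠ o`, a path `x₁, x₂, …` for each `x ∈ N_o`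
(`path x n` is the vertex `x_{n+1}`), and a vertex `x_c` for each `x ∈ N_c`. -/
inductive ModVertex (G : WeightedGraph V) (o : V) : Type _
  | old (x : {x : V // x ≠ o}) : ModVertex G o
  | path (x : G.pathNeighbors o) (n : ℕ) : ModVertex G o
  | leaf (x : G.constNeighbors o) : ModVertex G o

/-- `Go` is a graph `b_o` over `(X_o, m_o)` obtained from `b` over `(X, m)` by removing `o`. -/
structure IsModification (G : WeightedGraph V) (o : V) (Go : WeightedGraph (G.ModVertex o)) :
    Prop where
  m_old : ∀ x, Go.m (.old x) = G.m x
  b_old_old : ∀ x y, Go.b (.old x) (.old y) = G.b x y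
  b_old_path : ∀ x y n, 0 < Go.b (.old x) (.path y n) ↔ (x : V) = y ∧ n = 0
  b_path_path : ∀ x y j k,
    0 < Go.b (.path x j) (.path y k) ↔ x = y ∧ (j = k + 1 ∨ k = j + 1)
  b_old_leaf : ∀ x y, 0 < Go.b (.old x) (.leaf y) ↔ (x : V) = y
  b_path_leaf : ∀ x n y, Go.b (.path x n) (.leaf y) = 0
  b_leaf_leaf : ∀ x y, Go.b (.leaf x) (.leaf y) = 0

/-! ### Path metrics, intrinsic metrics and completeness -/

/-- `σ` assigns a positive length to each edge (and vanishes on all other pairs). -/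
structure IsLengthFunction (G : WeightedGraph V) (σ : V → V → ℝ) : Prop where
  nonneg : ∀ x y, 0 ≤ σ x y
  symm : ∀ x y, σ x y = σ y x
  pos_iff : ∀ x y, 0 < σ x y ↔ G.toSimpleGraph.Adj x y

/-- The path metric `d_σ`, the infimum of the lengths of the finite paths from `x` to `y`. It is an
extended metric: `d_σ(x, y) = ∞` if `x` and `y` lie in different connected components. -/
noncomputable def pathDist (G : WeightedGraph V) (σ : V → V → ℝ) (x y : V) : ENNReal :=
  ⨅ p : G.toSimpleGraph.Walk x y, ENNReal.ofReal ((p.darts.map fun e => σ e.fst e.snd).sum)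

/-- `d` is intrinsic: `∑_y b(x, y) d(x, y)² ≤ m(x)` for all `x`. -/
def IsIntrinsic (G : WeightedGraph V) (d : V → V → ENNReal) : Prop :=
  ∀ x, ∑' y, ENNReal.ofReal (G.b x y) * d x y ^ 2 ≤ ENNReal.ofReal (G.m x)

/-- The infinite path `x 0 ∼ x 1 ∼ ⋯` is a geodesic for `d_σ`. -/
def IsInfiniteGeodesic (G : WeightedGraph V) (σ : V → V → ℝ) (x : ℕ → V) : Prop :=
  (∀ n, G.toSimpleGraph.Adj (x n) (x (n + 1))) ∧
  ∀ j k, j < k →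
    G.pathDist σ (x j) (x k) = ENNReal.ofReal (∑ i ∈ Finset.Ico j k, σ (x i) (x (i + 1)))

/-- Every infinite geodesic has infinite length. -/
def GeodesicallyComplete (G : WeightedGraph V) (σ : V → V → ℝ) : Prop :=
  ∀ x : ℕ → V, G.IsInfiniteGeodesic σ x → ¬ Summable fun n => σ (x n) (x (n + 1))

/-- Every Cauchy sequence for `d` converges. -/
def MetricallyComplete (d : V → V → ENNReal) : Prop :=
  ∀ u : ℕ → V,
    (∀ ε : ENNReal, 0 < ε → ∃ N, ∀ j ≥ N, ∀ k ≥ N, d (u j) (u k) < ε) →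
    ∃ v, ∀ ε : ENNReal, 0 < ε → ∃ N, ∀ k ≥ N, d (u k) v < ε

/-- Every ball of finite radius for `d` is a finite set. -/
def HasFiniteBalls (d : V → V → ENNReal) : Prop :=
  ∀ (v : V) (r : ENNReal), r < ⊤ → {w | d v w ≤ r}.Finite

end WeightedGraph

/-! An attached path is joined to the rest of the graph only at its first vertex. Distance travelled
along it, extended by zero, therefore varies by at most `σ` across each edge, so the path is a
geodesic and `d_σ = σ` on its edges. Intrinsicness then gives `σ² ≤ β μ` on the `r`-th edge, with
`β` the reciprocal edge weight and `μ` the mass of the far endpoint. With `B r = β 0 + ⋯ + β r`,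
write `β μ = (β / B²) (B² μ)`: the first factors have a telescoping bound, the second are summable
by hypothesis, so the path has finite length. Its vertices form a Cauchy sequence without limit
inside a ball of finite radius.

It remains to see that some path is attached. Since `lambda0 > 0`, the spectrum of `(L + 1)⁻¹` stays
away from `1`, and integrating the semigroup gives `L⁻¹`; hence `g` is a multiple of `L⁻¹ e_o`. If
`g` were constant on `o` and its neighbors, the energy pairing of `g` with the indicator of `o`
would vanish, whereas `L g` pairs nontrivially with it. -/

theorem sum_div_sq_partialSum_le {β : ℕ → ℝ} (hβ : ∀ n, 0 < β n) (N : ℕ) :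
    ∑ r ∈ Finset.range (N + 1), β r / (∑ n ∈ Finset.range (r + 1), β n) ^ 2 ≤
      2 / β 0 - 1 / ∑ n ∈ Finset.range (N + 1), β n := by
  induction N with
  | zero =>
    have h0 := (hβ 0).ne'
    simp only [zero_add, Finset.sum_range_one]
    apply le_of_eq
    field_simp
    norm_num
  | succ N ih =>
    rw [Finset.sum_range_succ]
    have hB : 0 < ∑ n ∈ Finset.range (N + 1), β n :=
      Finset.sum_pos (fun i _ => hβ i) (by simp)
    have hb := hβ (N + 1)
    -- Telescoping: `1/B - 1/(B + β) = β / (B (B + β))`, which dominates `β / (B + β)²`.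
    have key : β (N + 1) / (∑ n ∈ Finset.range (N + 1 + 1), β n) ^ 2 ≤
        1 / (∑ n ∈ Finset.range (N + 1), β n) - 1 / ∑ n ∈ Finset.range (N + 1 + 1), β n := by
      rw [Finset.sum_range_succ _ (N + 1)]
      set B := ∑ n ∈ Finset.range (N + 1), β n
      rw [div_sub_div _ _ hB.ne' (by positivity), div_le_div_iff₀ (by positivity) (by positivity)]
      nlinarith [mul_pos hb hb, mul_pos (mul_pos hb hb) (add_pos hB hb)]
    linarith

/-- A sequence `s` with `s² ≤ β μ` is summable if `∑ (β 0 + ⋯ + β r)² μ r` converges. -/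
theorem summable_of_sq_le_mul {β μ s : ℕ → ℝ} (hβ : ∀ n, 0 < β n) (hs0 : ∀ n, 0 ≤ s n)
    (hs : ∀ n, s n ^ 2 ≤ β n * μ n)
    (hsum : Summable fun r : ℕ => (∑ n ∈ Finset.range (r + 1), β n) ^ 2 * μ r) : Summable s := by
  have hB : ∀ r, 0 < ∑ n ∈ Finset.range (r + 1), β n := fun r =>
    Finset.sum_pos (fun i _ => hβ i) (by simp)
  have h1 : Summable fun r => β r / (∑ n ∈ Finset.range (r + 1), β n) ^ 2 := by
    refine summable_of_sum_range_le (c := 2 / β 0)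
      (fun r => div_nonneg (hβ r).le (sq_nonneg _)) fun N => ?_
    refine (Finset.sum_le_sum_of_subset_of_nonneg
      (Finset.range_mono (Nat.le_succ N)) fun r _ _ => div_nonneg (hβ r).le (sq_nonneg _)).trans
      ((sum_div_sq_partialSum_le hβ N).trans ?_)
    have := one_div_pos.2 (hB N)
    linarith
  refine Summable.of_nonneg_of_le hs0 (fun r => ?_) (h1.add hsum)
  have hμ : 0 ≤ μ r := by
    by_contra! h
    nlinarith [hs r, hβ r, sq_nonneg (s r), mul_neg_of_pos_of_neg (hβ r) h]
  have e : β r * μ r = β r / (∑ n ∈ Finset.range (r + 1), β n) ^ 2 *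
      ((∑ n ∈ Finset.range (r + 1), β n) ^ 2 * μ r) := by
    have := (hB r).ne'
    field_simp
  have ha : 0 ≤ β r / (∑ n ∈ Finset.range (r + 1), β n) ^ 2 :=
    div_nonneg (hβ r).le (sq_nonneg _)
  have hb : 0 ≤ (∑ n ∈ Finset.range (r + 1), β n) ^ 2 * μ r := mul_nonneg (sq_nonneg _) hμ
  have h2 := hs r
  rw [e] at h2
  -- Crude AM-GM: `s² ≤ a b ≤ (a + b)²`.
  refine abs_le_of_sq_le_sq' ?_ (add_nonneg ha hb) |>.2
  nlinarith [mul_nonneg ha hb]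

/-! ### Potentials, geodesics and lengths of the attached paths -/

namespace WeightedGraph

variable {V : Type*}

theorem abs_sub_le_walk_length {G : WeightedGraph V} {σ : V → V → ℝ} {h : V → ℝ}
    (hh : ∀ u v, G.toSimpleGraph.Adj u v → |h u - h v| ≤ σ u v) {u v : V}
    (p : G.toSimpleGraph.Walk u v) :
    |h u - h v| ≤ (p.darts.map fun e => σ e.fst e.snd).sum := by
  induction p with
  | nil => simp
  | @cons u w v e p ih =>
    simp only [SimpleGraph.Walk.darts_cons, List.map_cons, List.sum_cons]
    exact (abs_sub_le _ (h w) _).trans (add_le_add (hh _ _ e) ih)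

/-- The source of all lower bounds on `d_σ` below. Points in different components cause no trouble,
the infimum being `⊤`. -/
theorem ofReal_abs_sub_le_pathDist {G : WeightedGraph V} {σ : V → V → ℝ} {h : V → ℝ}
    (hh : ∀ u v, G.toSimpleGraph.Adj u v → |h u - h v| ≤ σ u v) (u v : V) :
    ENNReal.ofReal |h u - h v| ≤ G.pathDist σ u v :=
  le_iInf fun p => ENNReal.ofReal_le_ofReal (abs_sub_le_walk_length hh p)

theorem exists_walk_along {G : WeightedGraph V} (σ : V → V → ℝ) {x : ℕ → V}
    (hx : ∀ n, G.toSimpleGraph.Adj (x n) (x (n + 1))) {j k : ℕ} (hjk : j ≤ k) :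
    ∃ p : G.toSimpleGraph.Walk (x j) (x k),
      (p.darts.map fun e => σ e.fst e.snd).sum =
        ∑ i ∈ Finset.Ico j k, σ (x i) (x (i + 1)) := by
  induction k, hjk using Nat.le_induction with
  | base => exact ⟨.nil, by simp⟩
  | succ k hjk ih =>
    obtain ⟨p, hp⟩ := ih
    refine ⟨p.concat (hx k), ?_⟩
    rw [Finset.sum_Ico_succ_top hjk, ← hp]
    simp [SimpleGraph.Walk.darts_concat]

/-- A path along which a function with `|h u - h v| ≤ σ u v` on edges grows by `σ` at each step is
a geodesic. -/
theorem isInfiniteGeodesic_of_potential {G : WeightedGraph V} {σ : V → V → ℝ} {h : V → ℝ}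
    (hh : ∀ u v, G.toSimpleGraph.Adj u v → |h u - h v| ≤ σ u v) {x : ℕ → V}
    (hx : ∀ n, G.toSimpleGraph.Adj (x n) (x (n + 1)))
    (hhx : ∀ n, h (x n) = ∑ i ∈ Finset.range n, σ (x i) (x (i + 1))) :
    G.IsInfiniteGeodesic σ x := by
  refine ⟨hx, fun j k hjk => le_antisymm ?_ ?_⟩
  · obtain ⟨p, hp⟩ := exists_walk_along σ hx hjk.le
    exact (iInf_le _ p).trans (by rw [hp])
  · refine le_trans (ENNReal.ofReal_le_ofReal ?_) (ofReal_abs_sub_le_pathDist hh (x j) (x k))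
    rw [hhx, hhx, Finset.sum_Ico_eq_sub _ hjk.le, abs_sub_comm]
    exact le_abs_self _

variable {G : WeightedGraph V} {o : V}

open Classical in
/-- The distance travelled along the path attached to `x`; it vanishes off this path. -/
noncomputable def pathPotential (σ : G.ModVertex o → G.ModVertex o → ℝ) (x : G.pathNeighbors o) :
    G.ModVertex o → ℝ
  | .path y n =>
    if y = x then ∑ i ∈ Finset.range n, σ (.path x i) (.path x (i + 1)) else 0
  | _ => 0

variable {Go : WeightedGraph (G.ModVertex o)} {σ : G.ModVertex o → G.ModVertex o → ℝ}

theorem pathPotential_path (x : G.pathNeighbors o) (n : ℕ) :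
    pathPotential σ x (.path x n) =
      ∑ i ∈ Finset.range n, σ (.path x i) (.path x (i + 1)) := by
  simp [pathPotential]

theorem IsModification.adj_path (hGo : G.IsModification o Go) (x : G.pathNeighbors o) (n : ℕ) :
    Go.toSimpleGraph.Adj (.path x n) (.path x (n + 1)) :=
  (hGo.b_path_path x x n (n + 1)).2 ⟨rfl, .inr rfl⟩

/-- Equality holds along the path itself. Any other edge, including the one attaching the path, has
both ends at potential zero. -/
theorem IsModification.abs_pathPotential_sub_le (hGo : G.IsModification o Go)
    (hσ : Go.IsLengthFunction σ) (x : G.pathNeighbors o) (u v : G.ModVertex o)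
    (huv : Go.toSimpleGraph.Adj u v) :
    |pathPotential σ x u - pathPotential σ x v| ≤ σ u v := by
  have h0 := hσ.nonneg u v
  cases u with
  | old a =>
    cases v with
    | old b => simpa [pathPotential] using h0
    | leaf b => simpa [pathPotential] using h0
    | path y n =>
      obtain rfl := ((hGo.b_old_path a y n).1 huv).2
      simpa [pathPotential] using h0
  | leaf a =>
    cases v with
    | old b => simpa [pathPotential] using h0
    | leaf b => simpa [pathPotential] using h0
    | path y n => exact absurd huv.symm (hGo.b_path_leaf y n a).le.not_gt
  | path y n =>
    cases v with
    | old b =>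
      obtain rfl := ((hGo.b_old_path b y n).1 huv.symm).2
      simpa [pathPotential] using h0
    | leaf b => exact absurd huv (hGo.b_path_leaf y n b).le.not_gt
    | path z k =>
      obtain ⟨rfl, h⟩ := (hGo.b_path_path y z n k).1 huv
      by_cases hy : y = x
      · subst hy
        rcases h with rfl | rfl
        · simp [pathPotential_path, Finset.sum_range_succ, hσ.symm (.path y (k + 1)),
            abs_of_nonneg (hσ.nonneg (.path y k) (.path y (k + 1)))]
        · simp [pathPotential_path, Finset.sum_range_succ,
            abs_of_nonneg (hσ.nonneg (.path y n) (.path y (n + 1)))]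
      · simpa [pathPotential, hy] using h0

theorem IsModification.isInfiniteGeodesic_path (hGo : G.IsModification o Go)
    (hσ : Go.IsLengthFunction σ) (x : G.pathNeighbors o) :
    Go.IsInfiniteGeodesic σ (.path x) :=
  isInfiniteGeodesic_of_potential (hGo.abs_pathPotential_sub_le hσ x) (hGo.adj_path x)
    (pathPotential_path x)

/-- Keep a single term of the intrinsic inequality at the far endpoint of the edge. The potential
shows that no detour is shorter than the edge, so `d_σ` may be replaced by `σ`. -/
theorem IsModification.sq_length_le (hGo : G.IsModification o Go)
    (hσ : Go.IsLengthFunction σ) (hint : Go.IsIntrinsic (Go.pathDist σ)) (x : G.pathNeighbors o)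
    (n : ℕ) :
    σ (.path x n) (.path x (n + 1)) ^ 2 ≤
      1 / Go.b (.path x n) (.path x (n + 1)) * Go.m (.path x (n + 1)) := by
  have hb : 0 < Go.b (.path x n) (.path x (n + 1)) := hGo.adj_path x n
  have h0 := hσ.nonneg (.path x n) (.path x (n + 1))
  have h1 := (ENNReal.le_tsum (f := fun y => ENNReal.ofReal (Go.b (.path x (n + 1)) y) *
    Go.pathDist σ (.path x (n + 1)) y ^ 2) (.path x n)).trans (hint (.path x (n + 1)))
  have h2 : ENNReal.ofReal (σ (.path x n) (.path x (n + 1))) ≤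
      Go.pathDist σ (.path x (n + 1)) (.path x n) := by
    refine le_trans (ENNReal.ofReal_le_ofReal ?_)
      (ofReal_abs_sub_le_pathDist (hGo.abs_pathPotential_sub_le hσ x) _ _)
    simp only [pathPotential_path, Finset.sum_range_succ, add_sub_cancel_left]
    exact le_abs_self _
  have h3 : ENNReal.ofReal (Go.b (.path x (n + 1)) (.path x n)) *
      ENNReal.ofReal (σ (.path x n) (.path x (n + 1))) ^ 2 ≤
        ENNReal.ofReal (Go.m (.path x (n + 1))) :=
    le_trans (by gcongr) h1
  rw [Go.b_symm, ← ENNReal.ofReal_pow h0, ← ENNReal.ofReal_mul hb.le,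
    ENNReal.ofReal_le_ofReal_iff (Go.m_pos _).le] at h3
  rw [one_div, inv_mul_eq_div, le_div_iff₀ hb]
  linarith

theorem IsModification.summable_length (hGo : G.IsModification o Go)
    (hσ : Go.IsLengthFunction σ) (hint : Go.IsIntrinsic (Go.pathDist σ)) (x : G.pathNeighbors o)
    (hsum : Summable fun r : ℕ =>
      (∑ n ∈ Finset.range (r + 1), 1 / Go.b (.path x n) (.path x (n + 1))) ^ 2 *
        Go.m (.path x (r + 1))) :
    Summable fun n : ℕ => σ (.path x n) (.path x (n + 1)) :=
  summable_of_sq_le_mul (fun n => one_div_pos.2 (hGo.adj_path x n)) (fun _ => hσ.nonneg _ _)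
    (hGo.sq_length_le hσ hint x) hsum

/-- The path is Cauchy because tails of its length tend to zero. Each vertex has as potential some
partial sum of the length, which the path eventually exceeds by at least one fixed edge length, so
no vertex is a limit. -/
theorem IsModification.not_metricallyComplete (hGo : G.IsModification o Go)
    (hσ : Go.IsLengthFunction σ) (x : G.pathNeighbors o)
    (hs : Summable fun n : ℕ => σ (.path x n) (.path x (n + 1))) :
    ¬ MetricallyComplete (Go.pathDist σ) := by
  intro hc
  have hLip := hGo.abs_pathPotential_sub_le hσ x
  have hpos : ∀ n, 0 < σ (.path x n) (.path x (n + 1)) := fun n =>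
    (hσ.pos_iff _ _).2 (hGo.adj_path x n)
  have hdist : ∀ j k, Go.pathDist σ (.path x j) (.path x k) ≤
      ENNReal.ofReal (∑' i, σ (.path x (i + min j k)) (.path x (i + min j k + 1))) := by
    have hle : ∀ j k, j ≤ k → ∑ i ∈ Finset.Ico j k, σ (.path x i) (.path x (i + 1)) ≤
        ∑' i, σ (.path x (i + j)) (.path x (i + j + 1)) := by
      intro j k hjk
      rw [Finset.sum_Ico_eq_sum_range]
      simp_rw [add_comm j]
      exact ((summable_nat_add_iff j).2 hs).sum_le_tsum _ fun i _ => hσ.nonneg _ _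
    intro j k
    rcases le_total j k with hjk | hjk
    · rw [min_eq_left hjk]
      obtain ⟨p, hp⟩ := exists_walk_along σ (hGo.adj_path x) hjk
      exact (iInf_le _ p).trans (ENNReal.ofReal_le_ofReal (hp.trans_le (hle j k hjk)))
    · rw [min_eq_right hjk]
      obtain ⟨p, hp⟩ := exists_walk_along σ (hGo.adj_path x) hjk
      refine (iInf_le _ p.reverse).trans (ENNReal.ofReal_le_ofReal (le_trans (le_of_eq ?_)
        (hp.trans_le (hle k j hjk))))
      simp only [SimpleGraph.Walk.darts_reverse, List.map_reverse, List.sum_reverse, List.map_map]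
      congr 2
      funext e
      exact hσ.symm _ _
  have htail : Filter.Tendsto
      (fun n => ENNReal.ofReal (∑' i, σ (.path x (i + n)) (.path x (i + n + 1))))
      Filter.atTop (nhds 0) := by
    have := ENNReal.tendsto_ofReal (tendsto_sum_nat_add
      fun n => σ (ModVertex.path x n) (ModVertex.path x (n + 1)))
    simpa using this
  obtain ⟨v, hv⟩ := hc (.path x) (fun ε hε => by
    obtain ⟨N, hN⟩ := Filter.eventually_atTop.1 (htail.eventually (gt_mem_nhds hε))
    exact ⟨N, fun j hj k hk => (hdist j k).trans_lt (hN _ (le_min hj hk))⟩)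
  obtain ⟨n, hn⟩ : ∃ n, pathPotential σ x v =
      ∑ i ∈ Finset.range n, σ (.path x i) (.path x (i + 1)) := by
    cases v with
    | old a => exact ⟨0, rfl⟩
    | leaf a => exact ⟨0, rfl⟩
    | path y n =>
      by_cases hy : y = x
      · exact ⟨n, by rw [hy, pathPotential_path]⟩
      · exact ⟨0, by simp [pathPotential, hy]⟩
  obtain ⟨N, hN⟩ := hv _ (ENNReal.ofReal_pos.2 (hpos n))
  have h1 := (ofReal_abs_sub_le_pathDist hLip _ v).trans_lt (hN (max N (n + 1)) (le_max_left _ _))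
  rw [ENNReal.ofReal_lt_ofReal_iff (hpos n), pathPotential_path, hn] at h1
  have h2 := Finset.sum_le_sum_of_subset_of_nonneg
    (Finset.range_mono (le_max_right N (n + 1)))
    fun i _ _ => hσ.nonneg (ModVertex.path x i) (ModVertex.path x (i + 1))
  rw [Finset.sum_range_succ] at h2
  linarith [le_abs_self (∑ i ∈ Finset.range (max N (n + 1)), σ (.path x i) (.path x (i + 1)) -
    ∑ i ∈ Finset.range n, σ (.path x i) (.path x (i + 1)))]

theorem IsModification.not_hasFiniteBalls (hGo : G.IsModification o Go)
    (hσ : Go.IsLengthFunction σ) (x : G.pathNeighbors o)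
    (hs : Summable fun n : ℕ => σ (.path x n) (.path x (n + 1))) :
    ¬ HasFiniteBalls (Go.pathDist σ) := by
  intro hf
  refine Set.infinite_of_injective_forall_mem (f := fun n => ModVertex.path x n)
    (fun j k h => by simpa using h) (fun n => ?_)
    (hf (.path x 0) (ENNReal.ofReal (∑' n, σ (.path x n) (.path x (n + 1))))
      ENNReal.ofReal_lt_top)
  obtain ⟨p, hp⟩ := exists_walk_along σ (hGo.adj_path x) (Nat.zero_le n)
  exact le_trans (b := ENNReal.ofReal _) (iInf_le _ p) (ENNReal.ofReal_le_ofReal (hp.trans_le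
    (hs.sum_le_tsum _ fun i _ => hσ.nonneg _ _)))

end WeightedGraph

/-! ### Integrating the semigroup by functional calculus -/

section FunctionalCalculus

open MeasureTheory

/-- The symbol of the heat semigroup is dominated by `e^{-ct}` on `[0, 1/(1+c)]`. -/
theorem norm_heatSymbol_le {c t s : ℝ} (hc : 0 < c) (ht : 0 < t) (hs : s ≤ 1 / (1 + c)) :
    ‖if 0 < s then Real.exp (-t * (1 / s - 1)) else 0‖ ≤ Real.exp (-c * t) := by
  split_ifs with h
  · rw [Real.norm_eq_abs, abs_of_pos (Real.exp_pos _), Real.exp_le_exp]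
    have : 1 + c ≤ 1 / s := by rwa [le_one_div (by positivity) h]
    nlinarith
  · simpa using (Real.exp_pos _).le

/-- The point `s = 0` must be included: it lies in the spectrum of the resolvent when `L` is
unbounded. -/
theorem continuousOn_heatSymbol :
    ContinuousOn (Function.uncurry fun t s : ℝ =>
      if 0 < s then Real.exp (-t * (1 / s - 1)) else 0) (Set.Ioi 0 ×ˢ Set.Ici 0) := by
  rintro ⟨t, s⟩ ⟨ht, hs⟩
  rcases (show (0 : ℝ) ≤ s from hs).eq_or_lt with rfl | hs
  · simp only [ContinuousWithinAt, Function.uncurry_apply_pair, lt_irrefl, if_false]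
    have ht : (0 : ℝ) < t := ht
    -- From `e^u ≥ u` one gets `e^{-a/s} ≤ s/a`, and `a > t/2` near `t`.
    have hbound : ∀ᶠ p in nhdsWithin ((t, 0) : ℝ × ℝ) (Set.Ioi 0 ×ˢ Set.Ici 0),
        ‖Function.uncurry (fun t s : ℝ => if 0 < s then Real.exp (-t * (1 / s - 1)) else 0) p‖ ≤
          Real.exp (p.1) * (2 / t * p.2) := by
      have : ∀ᶠ p in nhds ((t, 0) : ℝ × ℝ), t / 2 < p.1 :=
        continuous_fst.continuousAt.eventually (lt_mem_nhds (by simpa using ht))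
      filter_upwards [self_mem_nhdsWithin, mem_nhdsWithin_of_mem_nhds this] with p hp hpt
      obtain ⟨a, s⟩ := p
      have ha : 0 < a := hp.1
      have hs : 0 ≤ s := hp.2
      simp only [Function.uncurry_apply_pair] at hpt ⊢
      split_ifs with h
      · rw [Real.norm_eq_abs, abs_of_pos (Real.exp_pos _),
          show -a * (1 / s - 1) = a + -(a / s) by ring, Real.exp_add]
        gcongr
        rw [Real.exp_neg, inv_le_comm₀ (Real.exp_pos _) (by positivity)]
        have h1 := Real.add_one_le_exp (a / s)
        have h2 : (2 / t * s)⁻¹ = t / 2 / s := by field_simp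
        have h3 : t / 2 / s ≤ a / s := by gcongr
        linarith
      · simp only [norm_zero]
        positivity
    refine squeeze_zero_norm' hbound (Filter.Tendsto.mono_left ?_ nhdsWithin_le_nhds)
    have : Continuous fun p : ℝ × ℝ => Real.exp p.1 * (2 / t * p.2) := by fun_prop
    simpa using this.tendsto (t, 0)
  · refine ContinuousAt.continuousWithinAt ?_
    have h1 : ContinuousAt (fun p : ℝ × ℝ => Real.exp (-p.1 * (1 / p.2 - 1))) (t, s) := by
      have : ContinuousAt (fun p : ℝ × ℝ => 1 / p.2) (t, s) :=
        continuousAt_const.div continuousAt_snd hs.ne'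
      fun_prop
    refine h1.congr ?_
    filter_upwards [continuous_snd.continuousAt.eventually
      (lt_mem_nhds (show (0 : ℝ) < (t, s).2 from hs))] with p hp
    simp [Function.uncurry_def, hp]

theorem integral_heatSymbol {s : ℝ} (h0 : 0 ≤ s) (h1 : s < 1) :
    ∫ t in Set.Ioi (0 : ℝ), (if 0 < s then Real.exp (-t * (1 / s - 1)) else 0) = s / (1 - s) := by
  rcases h0.eq_or_lt with rfl | h
  · simp
  · have hpos : 0 < 1 / s - 1 := by
      have := one_lt_one_div h h1
      linarith
    simp only [h, if_true]
    have := integral_exp_mul_Ioi (a := -(1 / s - 1)) (by linarith) 0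
    simp only [mul_zero, Real.exp_zero] at this
    rw [show (fun t : ℝ => Real.exp (-t * (1 / s - 1))) =
      fun t => Real.exp (-(1 / s - 1) * t) by funext t; ring_nf, this]
    have : 1 - s ≠ 0 := by linarith
    field_simp

variable {H : Type*} [NormedAddCommGroup H] [InnerProductSpace ℂ H] [CompleteSpace H]

theorem integrableOn_expNegOfResolvent {R : H →L[ℂ] H} {c : ℝ} (hc : 0 < c)
    (hR : IsSelfAdjoint R) (hspec : ∀ s ∈ spectrum ℝ R, 0 ≤ s ∧ s ≤ 1 / (1 + c)) :
    IntegrableOn (expNegOfResolvent R) (Set.Ioi 0) := by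
  refine integrableOn_cfc measurableSet_Ioi _ (fun t => Real.exp (-c * t)) R
    (continuousOn_heatSymbol.mono (Set.prod_mono le_rfl fun s hs => (hspec s hs).1)) ?_
    (integrableOn_exp_mul_Ioi (by linarith) 0).2 hR
  exact (ae_restrict_iff' measurableSet_Ioi).2 (.of_forall fun t ht s hs =>
    norm_heatSymbol_le hc ht (hspec s hs).2)

/-- The operator `L⁻¹` for a self-adjoint operator `L > 0` with `R = (L + 1)⁻¹`. -/
noncomputable def invOfResolvent (R : H →L[ℂ] H) : H →L[ℂ] H :=
  cfc (fun s : ℝ => s / (1 - s)) R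

theorem isSelfAdjoint_invOfResolvent (R : H →L[ℂ] H) : IsSelfAdjoint (invOfResolvent R) :=
  cfc_predicate _ _

theorem integral_expNegOfResolvent {R : H →L[ℂ] H} {c : ℝ} (hc : 0 < c)
    (hR : IsSelfAdjoint R) (hspec : ∀ s ∈ spectrum ℝ R, 0 ≤ s ∧ s ≤ 1 / (1 + c)) :
    ∫ t in Set.Ioi (0 : ℝ), expNegOfResolvent R t = invOfResolvent R := by
  have h := cfc_setIntegral (μ := volume) measurableSet_Ioi
    (fun t s : ℝ => if 0 < s then Real.exp (-t * (1 / s - 1)) else 0)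
    (fun t => Real.exp (-c * t)) R
    (continuousOn_heatSymbol.mono (Set.prod_mono le_rfl fun s hs => (hspec s hs).1))
    ((ae_restrict_iff' measurableSet_Ioi).2 (.of_forall fun t ht s hs =>
      norm_heatSymbol_le hc ht (hspec s hs).2))
    (integrableOn_exp_mul_Ioi (by linarith) 0).2 hR
  refine h.symm.trans (cfc_congr fun s hs => integral_heatSymbol (hspec s hs).1 ?_)
  refine (hspec s hs).2.trans_lt ?_
  rw [div_lt_one (by positivity)]
  linarith

/-- `(L + 1)⁻¹ (L⁻¹ + 1) = L⁻¹`. -/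
theorem mul_invOfResolvent_add_one {R : H →L[ℂ] H} {c : ℝ} (hc : 0 < c)
    (hR : IsSelfAdjoint R) (hspec : ∀ s ∈ spectrum ℝ R, 0 ≤ s ∧ s ≤ 1 / (1 + c)) :
    R * (invOfResolvent R + 1) = invOfResolvent R := by
  unfold invOfResolvent
  have hlt : ∀ s ∈ spectrum ℝ R, 1 - s ≠ 0 := fun s hs => by
    have h1 : 1 / (1 + c) < 1 := by
      rw [div_lt_one (by positivity)]
      linarith
    linarith [(hspec s hs).2]
  have hcont : ContinuousOn (fun s : ℝ => s / (1 - s)) (spectrum ℝ R) :=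
    continuousOn_id.div (by fun_prop) hlt
  have e1 : cfc (fun s : ℝ => s / (1 - s)) R + 1 = cfc (fun s : ℝ => s / (1 - s) + 1) R := by
    rw [cfc_add (a := R) _ _ hcont, cfc_const_one ℝ R]
  have e2 : R * cfc (fun s : ℝ => s / (1 - s) + 1) R =
      cfc (fun s : ℝ => s * (s / (1 - s) + 1)) R := by
    rw [cfc_mul (a := R) _ (fun s : ℝ => s / (1 - s) + 1) (continuousOn_id' _)
      (hcont.add continuousOn_const), cfc_id' ℝ R]
  rw [e1, e2]
  refine cfc_congr fun s hs => ?_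
  have := hlt s hs
  field_simp
  ring

/-- `S S*` is positive with norm at most `‖S‖² ≤ C`. Applied to the form inclusion, this turns the
Rayleigh bound into a spectral gap. -/
theorem spectrum_self_comp_adjoint_subset {E : Type*} [NormedAddCommGroup E]
    [InnerProductSpace ℂ E] [CompleteSpace E] {S : E →L[ℂ] H} {C : ℝ}
    (hC : ∀ v, ‖S v‖ ^ 2 ≤ C * ‖v‖ ^ 2) (hC0 : 0 ≤ C) :
    ∀ s ∈ spectrum ℝ (S.comp (ContinuousLinearMap.adjoint S)), 0 ≤ s ∧ s ≤ C := by
  intro s hs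
  have hpos := ContinuousLinearMap.isPositive_self_comp_adjoint S
  refine ⟨spectrum_nonneg_of_nonneg
    ((ContinuousLinearMap.nonneg_iff_isPositive _).2 hpos) hs, ?_⟩
  have hS : ‖S‖ ≤ √C := by
    refine S.opNorm_le_bound (Real.sqrt_nonneg _) fun v => ?_
    rw [← Real.sqrt_sq (norm_nonneg v), ← Real.sqrt_mul hC0]
    exact Real.le_sqrt_of_sq_le (hC v)
  have hne : Nontrivial H := by
    by_contra hne
    rw [not_nontrivial_iff_subsingleton] at hne
    have : Subsingleton (H →L[ℂ] H) := ⟨fun f g => by ext v; exact Subsingleton.elim _ _⟩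
    rw [spectrum.of_subsingleton] at hs
    exact hs
  calc s ≤ ‖s‖ := Real.le_norm_self s
    _ ≤ ‖S.comp (ContinuousLinearMap.adjoint S)‖ := spectrum.norm_le_norm_of_mem hs
    _ ≤ ‖S‖ * ‖ContinuousLinearMap.adjoint S‖ := ContinuousLinearMap.opNorm_comp_le _ _
    _ = ‖S‖ * ‖S‖ := by rw [LinearIsometryEquiv.norm_map]
    _ ≤ √C * √C := by gcongr
    _ = C := Real.mul_self_sqrt hC0

end FunctionalCalculus

/-! ### The Green operator and its nonconstancy near the pole -/

namespace WeightedGraph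

variable {V : Type*} (G : WeightedGraph V)

/-- In the form domain the second component is determined by the first. -/
theorem formDomain_snd_apply {v : GradSpace V} (hv : v ∈ G.formDomain) (p : V × V) :
    v.snd p = (√(G.b p.1 p.2 / 2) : ℂ) *
      (v.fst p.1 / (√(G.m p.1) : ℂ) - v.fst p.2 / (√(G.m p.2) : ℂ)) := by
  have hev : ∀ {ι : Type _} (i : ι), Continuous fun f : Ell2 ι => f i := fun i =>
    (lp.evalCLM ℂ (fun _ => ℂ) 2 i).continuous
  have hfst : Continuous fun v : GradSpace V => v.fst := (WithLp.fstL 2 ℂ _ _).continuous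
  have hsnd : Continuous fun v : GradSpace V => v.snd := (WithLp.sndL 2 ℂ _ _).continuous
  refine closure_minimal (t := {v : GradSpace V | v.snd p = (√(G.b p.1 p.2 / 2) : ℂ) *
      (v.fst p.1 / (√(G.m p.1) : ℂ) - v.fst p.2 / (√(G.m p.2) : ℂ))}) ?_ ?_ hv
  · rintro v ⟨φ, h1, h2⟩
    have hm : ∀ x, (√(G.m x) : ℂ) ≠ 0 := fun x => by
      exact_mod_cast (Real.sqrt_pos.2 (G.m_pos x)).ne'
    simp only [Set.mem_ofPred_eq, h1, h2, mul_div_cancel_left₀ _ (hm _)]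
  · have h1 := (hev p.1).comp hfst
    have h2 := (hev p.2).comp hfst
    have h3 := (hev p).comp hsnd
    simp only [Function.comp_def] at h1 h2 h3
    refine isClosed_eq h3 ?_
    exact continuous_const.mul ((h1.div_const _).sub (h2.div_const _))

theorem energy_nonneg (f : V → ℝ) : 0 ≤ G.energy f :=
  mul_nonneg (by norm_num) (tsum_nonneg fun p => mul_nonneg (G.b_nonneg _ _) (sq_nonneg _))

theorem normSq_nonneg (f : V → ℝ) : 0 ≤ G.normSq f :=
  tsum_nonneg fun x => mul_nonneg (sq_nonneg _) (G.m_pos x).le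

theorem lambda0_mul_normSq_le_energy (φ : V →₀ ℝ) :
    G.lambda0 * G.normSq φ ≤ G.energy φ := by
  by_cases hφ : φ = 0
  · subst hφ
    simpa [normSq] using G.energy_nonneg _
  obtain ⟨x, hx⟩ : ∃ x, φ x ≠ 0 := by
    by_contra! h
    exact hφ (Finsupp.ext h)
  have hpos : 0 < G.normSq φ := by
    have hsum : Summable fun x => φ x ^ 2 * G.m x :=
      summable_of_hasFiniteSupport (φ.hasFiniteSupport.subset fun x hx h0 => hx (by simp [h0]))
    exact hsum.tsum_pos (fun y => mul_nonneg (sq_nonneg _) (G.m_pos y).le) x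
      (mul_pos (by positivity) (G.m_pos x))
  rw [← le_div_iff₀ hpos]
  -- The real `sInf` is a lower bound only because the quotients are bounded below, here by `0`.
  refine csInf_le ⟨0, ?_⟩ ⟨φ, hφ, rfl⟩
  rintro _ ⟨ψ, -, rfl⟩
  exact div_nonneg (G.energy_nonneg _) (G.normSq_nonneg _)

/-- Both sides are continuous in the form norm, so the core suffices; there, real and imaginary
parts are treated separately. -/
theorem lambda0_mul_norm_fst_sq_le {v : GradSpace V} (hv : v ∈ G.formDomain) :
    G.lambda0 * ‖v.fst‖ ^ 2 ≤ ‖v.snd‖ ^ 2 := by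
  have hfst : Continuous fun v : GradSpace V => v.fst := (WithLp.fstL 2 ℂ _ _).continuous
  have hsnd : Continuous fun v : GradSpace V => v.snd := (WithLp.sndL 2 ℂ _ _).continuous
  refine closure_minimal (t := {v : GradSpace V | G.lambda0 * ‖v.fst‖ ^ 2 ≤ ‖v.snd‖ ^ 2}) ?_
    (isClosed_le (continuous_const.mul (hfst.norm.pow 2)) (hsnd.norm.pow 2)) hv
  rintro v ⟨φ, h1, h2⟩
  have hn : ∀ {ι : Type _} (f : Ell2 ι), HasSum (fun i => ‖f i‖ ^ 2) (‖f‖ ^ 2) := fun f => by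
    simpa using lp.hasSum_norm (p := 2) (by norm_num) f
  let φr : V →₀ ℝ := φ.mapRange Complex.re rfl
  let φi : V →₀ ℝ := φ.mapRange Complex.im rfl
  have hS : ∀ ψ : V →₀ ℝ, Summable fun x => ψ x ^ 2 * G.m x := fun ψ =>
    summable_of_hasFiniteSupport (ψ.hasFiniteSupport.subset fun x hx h0 => hx (by simp [h0]))
  have e1 : ‖v.fst‖ ^ 2 = G.normSq φr + G.normSq φi := by
    rw [← (hn v.fst).tsum_eq, normSq, normSq, ← (hS φr).tsum_add (hS φi)]
    refine tsum_congr fun x => ?_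
    rw [h1, norm_mul, mul_pow, Complex.norm_real, Real.norm_eq_abs, sq_abs,
      Real.sq_sqrt (G.m_pos x).le, Complex.sq_norm, Complex.normSq_apply]
    simp only [φr, φi, Finsupp.mapRange_apply]
    ring
  have e2 : ∀ p : V × V, ‖v.snd p‖ ^ 2 = 1 / 2 * (G.b p.1 p.2 * (φr p.1 - φr p.2) ^ 2) +
      1 / 2 * (G.b p.1 p.2 * (φi p.1 - φi p.2) ^ 2) := fun p => by
    rw [h2, norm_mul, mul_pow, Complex.norm_real, Real.norm_eq_abs, sq_abs,
      Real.sq_sqrt (div_nonneg (G.b_nonneg _ _) (by norm_num)), Complex.sq_norm,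
      Complex.normSq_apply]
    simp only [φr, φi, Finsupp.mapRange_apply, Complex.sub_re, Complex.sub_im]
    ring
  have hr0 : ∀ (ψ : V →₀ ℝ) (p : V × V), 0 ≤ 1 / 2 * (G.b p.1 p.2 * (ψ p.1 - ψ p.2) ^ 2) :=
    fun ψ p => mul_nonneg (by norm_num) (mul_nonneg (G.b_nonneg _ _) (sq_nonneg _))
  have hsr : Summable fun p : V × V => 1 / 2 * (G.b p.1 p.2 * (φr p.1 - φr p.2) ^ 2) :=
    .of_nonneg_of_le (hr0 φr) (fun p => by rw [e2]; linarith [hr0 φi p]) (hn v.snd).summable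
  have hsi : Summable fun p : V × V => 1 / 2 * (G.b p.1 p.2 * (φi p.1 - φi p.2) ^ 2) :=
    .of_nonneg_of_le (hr0 φi) (fun p => by rw [e2]; linarith [hr0 φr p]) (hn v.snd).summable
  have e3 : ‖v.snd‖ ^ 2 = G.energy φr + G.energy φi := by
    rw [← (hn v.snd).tsum_eq, energy, energy, ← tsum_mul_left, ← tsum_mul_left,
      ← hsr.tsum_add hsi]
    exact tsum_congr e2
  rw [Set.mem_ofPred_eq, e1, e3, mul_add]
  exact add_le_add (G.lambda0_mul_normSq_le_energy φr) (G.lambda0_mul_normSq_le_energy φi)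

theorem norm_formIncl_sq_le (hlam : 0 < G.lambda0) (v : G.formDomain) :
    ‖G.formIncl v‖ ^ 2 ≤ 1 / (1 + G.lambda0) * ‖v‖ ^ 2 := by
  have h := G.lambda0_mul_norm_fst_sq_le v.2
  have e : ‖v‖ ^ 2 = ‖(v : GradSpace V).fst‖ ^ 2 + ‖(v : GradSpace V).snd‖ ^ 2 := by
    rw [Submodule.coe_norm, WithLp.prod_norm_sq_eq_of_L2]
  change ‖(v : GradSpace V).fst‖ ^ 2 ≤ _
  rw [e, one_div, inv_mul_eq_div, le_div_iff₀ (by positivity)]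
  linarith

theorem isSelfAdjoint_resolvent : IsSelfAdjoint G.resolvent :=
  (ContinuousLinearMap.isPositive_self_comp_adjoint G.formIncl).isSelfAdjoint

theorem spectrum_resolvent (hlam : 0 < G.lambda0) :
    ∀ s ∈ spectrum ℝ G.resolvent, 0 ≤ s ∧ s ≤ 1 / (1 + G.lambda0) :=
  spectrum_self_comp_adjoint_subset (G.norm_formIncl_sq_le hlam) (by positivity)

/-- The inverse of the Laplacian of a graph with positive bottom of the spectrum. -/
noncomputable def greenOperator : Ell2 V →L[ℂ] Ell2 V :=
  invOfResolvent G.resolvent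

theorem isSelfAdjoint_greenOperator : IsSelfAdjoint G.greenOperator :=
  isSelfAdjoint_invOfResolvent _

theorem isLaplacian_greenOperator (hlam : 0 < G.lambda0) (f : Ell2 V) :
    G.IsLaplacian (G.greenOperator f) f := by
  rw [isLaplacian_iff]
  exact congrArg (fun T : Ell2 V →L[ℂ] Ell2 V => T f)
    (mul_invOfResolvent_add_one hlam G.isSelfAdjoint_resolvent (G.spectrum_resolvent hlam))

open Classical in
-- A matrix entry is a continuous real-linear functional, so it passes through the operator-valued
-- integral. Self-adjointness then swaps the indices, making `green x` the profile of one vector,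
-- `L⁻¹ e_x`.
theorem green_eq (hlam : 0 < G.lambda0) (x y : V) :
    G.green x y = (G.greenOperator (lp.single 2 x (1 : ℂ)) y).re / (√(G.m x) * √(G.m y)) := by
  let ev : (Ell2 V →L[ℂ] Ell2 V) →L[ℝ] ℝ :=
    Complex.reCLM.comp (((lp.evalCLM ℂ (fun _ => ℂ) 2 x).comp
      (ContinuousLinearMap.apply ℂ (Ell2 V) (lp.single 2 y (1 : ℂ)))).restrictScalars ℝ)
  have hev : ∀ T, ev T = (T (lp.single 2 y (1 : ℂ)) x).re := fun T => rfl
  have h1 : G.green x y = ev (G.greenOperator) / (√(G.m x) * √(G.m y)) := by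
    simp only [green, heatKernel, ← hev]
    rw [MeasureTheory.integral_div]
    congr 1
    rw [greenOperator, ← integral_expNegOfResolvent hlam G.isSelfAdjoint_resolvent
      (G.spectrum_resolvent hlam)]
    exact ev.integral_comp_comm (integrableOn_expNegOfResolvent hlam G.isSelfAdjoint_resolvent
      (G.spectrum_resolvent hlam))
  rw [h1, hev]
  congr 1
  have h2 := ContinuousLinearMap.isSelfAdjoint_iff_isSymmetric.1 G.isSelfAdjoint_greenOperator
    (lp.single 2 x (1 : ℂ)) (lp.single 2 y (1 : ℂ))
  rw [ContinuousLinearMap.coe_coe, lp.inner_single_left, lp.inner_single_right] at h2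
  simpa using (congrArg Complex.re h2).symm

open Classical in
/-- The indicator function of a vertex, as an element of the form core. -/
theorem exists_single_mem_formCore (hlf : G.IsLocallyFinite) (o : V) :
    ∃ w ∈ G.formCore, w.fst = lp.single 2 o (√(G.m o) : ℂ) ∧ ∀ p : V × V,
      w.snd p = (√(G.b p.1 p.2 / 2) : ℂ) *
        (Finsupp.single o (1 : ℂ) p.1 - Finsupp.single o (1 : ℂ) p.2) := by
  let F : V × V → ℂ := fun p => (√(G.b p.1 p.2 / 2) : ℂ) *
        (Finsupp.single o (1 : ℂ) p.1 - Finsupp.single o (1 : ℂ) p.2)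
  have hfin : {p | F p ≠ 0}.Finite := by
    -- Only edges at `o` contribute, so local finiteness gives finite support and hence membership
    -- in `ℓ²`.
    refine (((hlf o).image fun y => (o, y)).union ((hlf o).image fun y => (y, o))).subset ?_
    rintro ⟨x, y⟩ hp
    have hb : 0 < G.b x y := by
      refine (G.b_nonneg x y).lt_of_ne fun h => hp ?_
      simp [F, ← h]
    by_cases hx : x = o
    · subst hx
      exact .inl ⟨y, hb, rfl⟩
    · by_cases hy : y = o
      · subst hy
        exact .inr ⟨x, by rw [G.b_symm] at hb; exact hb, rfl⟩
      · exact absurd (by simp [F, Finsupp.single_apply, Ne.symm hx, Ne.symm hy]) hp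
  have hF : Memℓp F 2 := (memℓp_zero hfin).of_exponent_ge zero_le
  refine ⟨WithLp.toLp 2 (lp.single 2 o (√(G.m o) : ℂ), (⟨F, hF⟩ : Ell2 (V × V))),
    ⟨Finsupp.single o 1, fun x => ?_, fun p => rfl⟩, rfl, fun p => rfl⟩
  by_cases hx : x = o
  · subst hx
    simp
  · simp [hx]

/-- A vertex `o` has a neighbor at which the Green's function with pole `o` differs from its value
at `o`. -/
theorem pathNeighbors_nonempty (hlf : G.IsLocallyFinite) (hlam : 0 < G.lambda0) (o : V) :
    (G.pathNeighbors o).Nonempty := by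
  classical
  by_contra hne
  have hmo := Real.sqrt_pos.2 (G.m_pos o)
  obtain ⟨v, hv, hvu, hL⟩ := G.isLaplacian_greenOperator hlam (lp.single 2 o (1 : ℂ))
  have hgreen : ∀ x, (v.fst x / (√(G.m x) : ℂ)).re = √(G.m o) * G.green o x := fun x => by
    have hmx := Real.sqrt_pos.2 (G.m_pos x)
    rw [G.green_eq hlam, hvu, Complex.div_ofReal_re]
    field_simp
  have hconst : ∀ x, 0 < G.b x o → G.green o x = G.green o o := fun x hx => by
    by_contra h
    exact hne ⟨x, hx, h⟩
  obtain ⟨w, hw, hw1, hw2⟩ := G.exists_single_mem_formCore hlf o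
  have h1 := hL w (Submodule.le_topologicalClosure _ hw)
  have h2 : (inner ℂ w.snd v.snd).re = 0 := by
    have hs := Complex.hasSum_re (lp.hasSum_inner (𝕜 := ℂ) w.snd v.snd)
    refine hs.unique ?_
    convert! hasSum_zero using 1
    funext p
    obtain ⟨x, y⟩ := p
    rw [hw2, G.formDomain_snd_apply hv]
    -- Every term of the energy pairing vanishes: there is no edge, or the edge misses `o`, or `g`
    -- agrees at its ends. Only the real part of the solution is controlled by `green`, which
    -- suffices since the indicator is real.
    have key : G.b x y = 0 ∨ (Finsupp.single o (1 : ℂ) x - Finsupp.single o (1 : ℂ) y) = 0 ∨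
        (v.fst x / (√(G.m x) : ℂ) - v.fst y / (√(G.m y) : ℂ)).re = 0 := by
      rcases (G.b_nonneg x y).eq_or_lt with hb | hb
      · exact .inl hb.symm
      rw [Complex.sub_re, hgreen, hgreen]
      by_cases hx : x = o
      · subst hx
        rw [hconst y (by rwa [G.b_symm])]
        simp
      · by_cases hy : y = o
        · subst hy
          rw [hconst x hb]
          simp
        · simp [Ne.symm hx, Ne.symm hy]
    have hreal : ∃ r : ℝ, Finsupp.single o (1 : ℂ) x - Finsupp.single o (1 : ℂ) y = r :=
      ⟨(if o = x then 1 else 0) - (if o = y then 1 else 0), by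
        simp only [Finsupp.single_apply]
        split_ifs <;> simp⟩
    obtain ⟨r, hr⟩ := hreal
    rw [hr] at key ⊢
    rcases key with h | h | h
    · simp [h]
    · simp [h]
    · simp only [RCLike.inner_apply, map_mul, Complex.conj_ofReal]
      rw [show ∀ a z b : ℂ, a * z * (a * b) = a * (a * b) * z from fun _ _ _ => by ring]
      rw [← Complex.ofReal_mul, ← Complex.ofReal_mul, Complex.re_ofReal_mul, h, mul_zero]
  -- The weak equation evaluates the same pairing as `√(m o)`, which is nonzero.
  rw [h1, lp.inner_single_right, hw1] at h2
  simp [hmo.ne'] at h2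

end WeightedGraph

theorem mainTheorem9 {X : Type*} [Countable X] [Infinite X]
    (G : WeightedGraph X)
    (hconn : G.toSimpleGraph.Connected)
    (hlf : G.IsLocallyFinite)
    (hlam : 0 < G.lambda0)
    (o : X)
    (Go : WeightedGraph (G.ModVertex o))
    (hGo : G.IsModification o Go)
    (hsum : ∀ x : G.pathNeighbors o, Summable fun r : ℕ =>
      (∑ n ∈ Finset.range (r + 1), 1 / Go.b (.path x n) (.path x (n + 1))) ^ 2 *
        Go.m (.path x (r + 1))) :
    ∀ σ : G.ModVertex o → G.ModVertex o → ℝ,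
      Go.IsLengthFunction σ → Go.IsIntrinsic (Go.pathDist σ) →
        (¬ Go.GeodesicallyComplete σ ∧
          ¬ WeightedGraph.MetricallyComplete (Go.pathDist σ) ∧
          ¬ WeightedGraph.HasFiniteBalls (Go.pathDist σ)) ∧
        ∀ x : G.pathNeighbors o, Summable fun n : ℕ => σ (.path x n) (.path x (n + 1)) := by
  intro σ hσ hint
  have hlen : ∀ x : G.pathNeighbors o,
      Summable fun n : ℕ => σ (.path x n) (.path x (n + 1)) := fun x =>
    hGo.summable_length hσ hint x (hsum x)
  obtain ⟨x, hx⟩ := G.pathNeighbors_nonempty hlf hlam o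
  exact ⟨⟨fun hc => hc _ (hGo.isInfiniteGeodesic_path hσ ⟨x, hx⟩) (hlen ⟨x, hx⟩),
    hGo.not_metricallyComplete hσ ⟨x, hx⟩ (hlen ⟨x, hx⟩),
    hGo.not_hasFiniteBalls hσ ⟨x, hx⟩ (hlen ⟨x, hx⟩)⟩, hlen⟩
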